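/- Let $t>\sqrt2$, and let $\beta=\beta(t)$ be the unique real number with $$1=\int_0^t \frac{u e^{-\beta u}}{1+e^{-\beta u}}\,du .$$ For $n\ge 1$ put $x=x_n=e^{-\beta/\sqrt n}$, and let $P_{x,n}$ be the probability measure on the set of all partitions $\lambda$ into distinct parts (of any size, the empty partition included) whose parts are all at most $t\sqrt n$, given by $$P_{x,n}(\lambda)=\frac{x^{|\lambda|}}{\prod_{k\le t\sqrt n}(1+x^k)},$$ where $|\lambda|$ is the sum of the parts of $\lambda$. Let $N(\lambda)=\sum_{k\le t\sqrt n}kX_k(\lambda)=|\lambda|$, where $X_k(\lambda)\in\{0,1\}$ is the multiplicity of $k$ as a part of $\lambda$, and let $\sigma_n^2=\operatorname{Var}_{x,n}(N)$ be the variance of $N$ under $P_{x,n}$, with $\sigma_n\ge 0$. Then for every $v\in\mathbb R$, $$\lim_{n\to\infty}P_{x,n}\!\left(\frac{N-n}{\sigma_n}\le v\right)=\frac1{\sqrt{2\pi}}\int_{-\infty}^v e^{-u^2/2}\,du .$$ Moreover, as $n\to\infty$, $$P_{x,n}(N=n)\sim\frac{1}{\sqrt{2\pi}\,\sigma_n}.$$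 -/

import Mathlib

open Filter Topology MeasureTheory ProbabilityTheory
open scoped Asymptotics

noncomputable section

namespace DistinctParts

/-- The integrand `u e^{-y u} / (1 + e^{-y u})` of the equation that defines `β(t)`. -/
def integrand (y u : ℝ) : ℝ :=
  u * Real.exp (-(y * u)) / (1 + Real.exp (-(y * u)))

theorem continuous_integrand : Continuous (Function.uncurry integrand) := by
  unfold Function.uncurry integrand
  refine Continuous.div (by fun_prop) (by fun_prop) fun p => ?_
  positivity

theorem integrand_eq (y u : ℝ) : integrand y u = u / (1 + Real.exp (y * u)) := by
  unfold integrand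
  rw [Real.exp_neg]
  have := Real.exp_pos (y * u)
  field_simp
  ring

theorem continuous_integrand_right (y : ℝ) : Continuous (integrand y) :=
  continuous_integrand.comp (by fun_prop : Continuous fun u : ℝ => (y, u))

/-- For every `t > √2` the equation `1 = ∫₀ᵗ u e^{-y u} / (1 + e^{-y u}) du` has exactly one real
solution `y`. -/
theorem existsUnique_beta {t : ℝ} (ht : √2 < t) :
    ∃! y : ℝ, 1 = ∫ u in (0 : ℝ)..t, integrand y u := by
  have ht0 : 0 < t := lt_of_le_of_lt (Real.sqrt_nonneg 2) ht
  have ht2 : 2 < t ^ 2 := (Real.sqrt_lt' ht0).1 ht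
  have hint (y : ℝ) : IntervalIntegrable (integrand y) volume 0 t :=
    (continuous_integrand_right y).intervalIntegrable _ _
  have hcont : Continuous fun y => ∫ u in (0 : ℝ)..t, integrand y u :=
    intervalIntegral.continuous_parametric_intervalIntegral_of_continuous' continuous_integrand 0 t
  have hup : ∫ u in (0 : ℝ)..t, integrand t u ≤ 1 := by
    have h : ∫ u in (0 : ℝ)..t, integrand t u ≤ ∫ u in (0 : ℝ)..t, 1 / t := by
      refine intervalIntegral.integral_mono_on ht0.le (hint t) (by simp) fun u hu => ?_
      rw [integrand_eq, div_le_div_iff₀ (by positivity) ht0]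
      nlinarith [Real.add_one_le_exp (t * u)]
    refine h.trans (le_of_eq ?_)
    rw [intervalIntegral.integral_const]
    simp [ht0.ne']
  have hc : 0 < t / (t ^ 2 / 2 - 1) := div_pos ht0 (by linarith)
  obtain ⟨c, hcdef⟩ : ∃ c, c = t / (t ^ 2 / 2 - 1) := ⟨_, rfl⟩
  rw [← hcdef] at hc
  have hlow : 1 ≤ ∫ u in (0 : ℝ)..t, integrand (-c) u := by
    have h : ∫ u in (0 : ℝ)..t, (u - 1 / c) ≤ ∫ u in (0 : ℝ)..t, integrand (-c) u := by
      refine intervalIntegral.integral_mono_on ht0.le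
        ((by fun_prop : Continuous fun u : ℝ => u - 1 / c).intervalIntegrable _ _)
        (hint (-c)) fun u hu => ?_
      have hu0 : 0 ≤ u := hu.1
      have he := Real.exp_pos (c * u)
      have h1 : integrand (-c) u = u - u / (1 + Real.exp (c * u)) := by
        unfold integrand
        rw [show -(-c * u) = c * u by ring]
        field_simp
        ring
      have h2 : u / (1 + Real.exp (c * u)) ≤ 1 / c := by
        rw [div_le_div_iff₀ (by positivity) hc]
        nlinarith [Real.add_one_le_exp (c * u)]
      rw [h1]
      linarith
    refine le_trans (le_of_eq ?_) h
    rw [intervalIntegral.integral_sub (by simp) (by simp)]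
    have : t ^ 2 / 2 - 1 ≠ 0 := by linarith
    simp only [integral_id, intervalIntegral.integral_const, smul_eq_mul, hcdef]
    field_simp
    ring
  obtain ⟨y, hy⟩ : ∃ y, ∫ u in (0 : ℝ)..t, integrand y u = 1 :=
    mem_range_of_exists_le_of_exists_ge hcont ⟨t, hup⟩ ⟨-c, hlow⟩
  have hanti : StrictAnti fun y => ∫ u in (0 : ℝ)..t, integrand y u := by
    intro a b hab
    refine intervalIntegral.integral_lt_integral_of_continuousOn_of_le_of_exists_lt ht0
      (continuous_integrand_right b).continuousOn (continuous_integrand_right a).continuousOn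
      (fun u hu => ?_) ⟨t, ⟨ht0.le, le_rfl⟩, ?_⟩
    · rw [integrand_eq, integrand_eq]
      have := hu.1.le
      gcongr
    · rw [integrand_eq, integrand_eq]
      gcongr
  exact ⟨y, hy.symm, fun z hz => hanti.injective (hz.symm.trans hy.symm)⟩

/-- `β(t)`: the unique real `y` with `1 = ∫₀ᵗ u e^{-y u} / (1 + e^{-y u}) du`, for `t > √2`. -/
def beta (t : ℝ) (ht : √2 < t) : ℝ := (existsUnique_beta ht).choose

theorem beta_spec {t : ℝ} (ht : √2 < t) :
    1 = ∫ u in (0 : ℝ)..t, integrand (beta t ht) u :=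
  (existsUnique_beta ht).choose_spec.1

/-- The admissible parts: the integers `k` with `1 ≤ k ≤ t √n`. -/
def parts (t : ℝ) (n : ℕ) : Finset ℕ := Finset.Icc 1 ⌊t * √(n : ℝ)⌋₊

theorem mem_parts {t : ℝ} {n k : ℕ} : k ∈ parts t n ↔ 1 ≤ k ∧ (k : ℝ) ≤ t * √(n : ℝ) := by
  unfold parts
  rw [Finset.mem_Icc, and_congr_right_iff]
  intro hk
  exact Nat.le_floor_iff' (by omega)

/-- The partitions (of any size) into distinct parts, all of them at most `t √n`. A partition into
distinct parts is the finite set of its parts. -/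
def Part (t : ℝ) (n : ℕ) : Type := {l : Finset ℕ // l ∈ (parts t n).powerset}

instance (t : ℝ) (n : ℕ) : Fintype (Part t n) :=
  inferInstanceAs (Fintype {l : Finset ℕ // l ∈ (parts t n).powerset})

instance (t : ℝ) (n : ℕ) : MeasurableSpace (Part t n) := ⊤

instance (t : ℝ) (n : ℕ) : DiscreteMeasurableSpace (Part t n) := ⟨fun _ => trivial⟩

/-- The size `|λ|` of a partition: the sum of its parts. -/
def Part.size {t : ℝ} {n : ℕ} (l : Part t n) : ℕ := ∑ k ∈ l.1, k

/-- The generating polynomial `∏_{k ≤ t √n} (1 + x^k)`. -/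
def genPoly (t : ℝ) (n : ℕ) (x : ℝ) : ℝ := ∏ k ∈ parts t n, (1 + x ^ k)

/-- The Boltzmann measure `P_{x,n}`, which gives mass `x^{|λ|} / ∏_{k ≤ t √n} (1 + x^k)` to the
partition `λ` (a probability measure for `x > 0`). -/
def boltzmann (t : ℝ) (n : ℕ) (x : ℝ) : Measure (Part t n) :=
  ∑ l : Part t n, ENNReal.ofReal (x ^ l.size / genPoly t n x) • Measure.dirac l

/-- `X_k`: the multiplicity of `k` in a partition. -/
def mult {t : ℝ} {n : ℕ} (k : ℕ) (l : Part t n) : ℕ := if k ∈ l.1 then 1 else 0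

/-- The random variable `N = ∑_{k ≤ t √n} k X_k`. -/
def N {t : ℝ} {n : ℕ} (l : Part t n) : ℝ := ∑ k ∈ parts t n, (k : ℝ) * (mult k l : ℝ)

/-- `σ_n`, the standard deviation of `N` under `P_{x,n}`. -/
def sigma (t : ℝ) (n : ℕ) (x : ℝ) : ℝ := √(Var[(N : Part t n → ℝ); boltzmann t n x])

theorem N_eq_size {t : ℝ} {n : ℕ} (l : Part t n) : N l = l.size := by
  have hl : l.1 ⊆ parts t n := Finset.mem_powerset.1 l.2
  simp only [N, mult, Part.size, Nat.cast_ite, Nat.cast_one, Nat.cast_zero, mul_ite, mul_one,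
    mul_zero, Nat.cast_sum]
  rw [← Finset.sum_filter, Finset.filter_mem_eq_inter, Finset.inter_eq_right.2 hl]

theorem sum_pow_size (t : ℝ) (n : ℕ) (x : ℝ) :
    ∑ l : Part t n, x ^ l.size = genPoly t n x := by
  have h : ∀ s ∈ (parts t n).powerset, ∏ k ∈ s, x ^ k = x ^ ∑ k ∈ s, k := fun s _ =>
    Finset.prod_pow_eq_pow_sum s (fun k => k) x
  unfold genPoly
  rw [Finset.prod_one_add, Finset.sum_congr rfl h]
  exact Finset.sum_coe_sort (parts t n).powerset fun s => x ^ ∑ k ∈ s, k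

theorem isProbabilityMeasure_boltzmann (t : ℝ) (n : ℕ) {x : ℝ} (hx : 0 < x) :
    IsProbabilityMeasure (boltzmann t n x) := by
  have hD : 0 < genPoly t n x := Finset.prod_pos fun k _ => by positivity
  constructor
  simp only [boltzmann, Measure.coe_finsetSum, Measure.coe_smul, Finset.sum_apply, Pi.smul_apply,
    measure_univ, smul_eq_mul, mul_one]
  rw [← ENNReal.ofReal_sum_of_nonneg fun l _ => by positivity, ← Finset.sum_div, sum_pow_size,
    div_self hD.ne', ENNReal.ofReal_one]

/-- The value `x = e^{-β/√n}` of the parameter, `β = β(t)`. -/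
def param (t : ℝ) (ht : √2 < t) (n : ℕ) : ℝ := Real.exp (-(beta t ht) / √(n : ℝ))

end DistinctParts

end

/-
Under `P_{x,n}` the multiplicities `X_k` are independent Bernoulli variables with success
probability `x^k / (1 + x^k)`, so `N = ∑ k X_k` is a sum of independent variables, each
bounded by `⌊t√n⌋ = o(σ_n)`, where `σ_n² ≍ n^{3/2}`. Its mean is `n` times a Riemann sum of mesh
`1/√n` of the integral in the definition of `β`, hence `n + O(√n) = n + o(σ_n)`. A second-order
expansion of the characteristic functions of the summands therefore gives the Gaussian limit for
that of `(N - n) / σ_n`, and Lévy's continuity theorem the first claim.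

For the second, Fourier inversion writes `σ_n P(N = n)` as `1/(2π)` times the integral of that
characteristic function over `|s| ≤ π σ_n`. The limit is taken under the integral by dominated
convergence: as `|E e^{iθX_k}| ≤ exp (-Var X_k (1 - cos θ))` with `Var X_k` bounded below, a lower
bound for `∑ (1 - cos kθ)` gives a majorant `C / (1 + s²)` on the whole range `|θ| ≤ π`.
-/

open scoped NNReal

theorem norm_prod_sub_prod_le_sum {ι R : Type*} [NormedCommRing R] [NormOneClass R]
    (s : Finset ι) {a b : ι → R} (ha : ∀ i ∈ s, ‖a i‖ ≤ 1) (hb : ∀ i ∈ s, ‖b i‖ ≤ 1) :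
    ‖∏ i ∈ s, a i - ∏ i ∈ s, b i‖ ≤ ∑ i ∈ s, ‖a i - b i‖ := by
  classical
  induction s using Finset.induction_on with
  | empty => simp
  | insert i s hi ih =>
    rw [Finset.forall_mem_insert] at ha hb
    rw [Finset.prod_insert hi, Finset.prod_insert hi, Finset.sum_insert hi]
    have hprod : ‖∏ j ∈ s, a j‖ ≤ 1 :=
      (Finset.norm_prod_le _ _).trans (Finset.prod_le_one (fun _ _ => norm_nonneg _) ha.2)
    calc ‖a i * ∏ j ∈ s, a j - b i * ∏ j ∈ s, b j‖
        = ‖(a i - b i) * ∏ j ∈ s, a j + b i * (∏ j ∈ s, a j - ∏ j ∈ s, b j)‖ := by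
          congr 1; ring
      _ ≤ ‖a i - b i‖ * ‖∏ j ∈ s, a j‖ + ‖b i‖ * ‖∏ j ∈ s, a j - ∏ j ∈ s, b j‖ :=
          (norm_add_le _ _).trans (add_le_add (norm_mul_le _ _) (norm_mul_le _ _))
      _ ≤ ‖a i - b i‖ * 1 + 1 * ∑ j ∈ s, ‖a j - b j‖ := by
          gcongr
          exacts [hb.1, ih ha.2 hb.2]
      _ = ‖a i - b i‖ + ∑ j ∈ s, ‖a j - b j‖ := by ring

theorem norm_exp_mul_I_sub_taylor_le {v : ℝ} (hv : |v| ≤ 1) :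
    ‖Complex.exp (v * Complex.I) - (1 + v * Complex.I - v ^ 2 / 2)‖ ≤ |v| ^ 3 := by
  have hn : ‖(v : ℂ) * Complex.I‖ = |v| := by simp
  have h := Complex.exp_bound (hn.trans_le hv) (n := 3) (by norm_num)
  have hsum : (∑ m ∈ Finset.range 3, ((v : ℂ) * Complex.I) ^ m / (m.factorial : ℂ))
      = 1 + v * Complex.I - v ^ 2 / 2 := by
    rw [Finset.sum_range_succ, Finset.sum_range_succ, Finset.sum_range_one, mul_pow _ _ 2,
      Complex.I_sq]
    norm_num [Nat.factorial]
    ring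
  rw [hn, hsum] at h
  refine h.trans (mul_le_of_le_one_right (by positivity) ?_)
  norm_num [Nat.factorial]

section CentralLimit

variable {Ω : Type*} {mΩ : MeasurableSpace Ω} {μ : Measure Ω}

theorem charFun_map_eq_integral {X : Ω → ℝ} (hX : AEMeasurable X μ) (s : ℝ) :
    charFun (μ.map X) s = ∫ ω, Complex.exp ((s * X ω : ℝ) * Complex.I) ∂μ := by
  rw [charFun_apply_real, integral_map hX (by fun_prop)]
  push_cast
  rfl

variable [IsProbabilityMeasure μ]

theorem norm_charFun_sub_taylor_le {X : Ω → ℝ} {b s : ℝ} (hX : AEMeasurable X μ)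
    (hXb : ∀ᵐ ω ∂μ, |X ω| ≤ b) (hX0 : μ[X] = 0) (hs : |s| * b ≤ 1) :
    ‖charFun (μ.map X) s - (1 - s ^ 2 * Var[X; μ] / 2 : ℝ)‖ ≤ b * |s| ^ 3 * Var[X; μ] := by
  have hX1 : Integrable X μ := .of_bound hX.aestronglyMeasurable b hXb
  have hX2 : Integrable (fun ω => X ω ^ 2) μ :=
    (MemLp.of_bound hX.aestronglyMeasurable b hXb : MemLp X 2 μ).integrable_sq
  have hvar : Var[X; μ] = ∫ ω, X ω ^ 2 ∂μ := variance_of_integral_eq_zero hX hX0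
  have hexp : Integrable (fun ω => Complex.exp ((s * X ω : ℝ) * Complex.I)) μ :=
    .of_bound (by fun_prop) 1 (.of_forall fun ω => (Complex.norm_exp_ofReal_mul_I _).le)
  have hre : Integrable (fun ω => ((1 - s ^ 2 / 2 * X ω ^ 2 : ℝ) : ℂ)) μ :=
    ((integrable_const _).sub (hX2.const_mul _)).ofReal
  have him : Integrable (fun ω => ((s * X ω : ℝ) : ℂ) * Complex.I) μ :=
    (hX1.const_mul s).ofReal.mul_const _
  have htaylor : ∫ ω, (((1 - s ^ 2 / 2 * X ω ^ 2 : ℝ) : ℂ) + (s * X ω : ℝ) * Complex.I) ∂μ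
      = (1 - s ^ 2 * Var[X; μ] / 2 : ℝ) := by
    rw [integral_add hre him, integral_mul_const, integral_complex_ofReal,
      integral_complex_ofReal, integral_const_mul, hX0,
      integral_sub (integrable_const _) (hX2.const_mul _), integral_const_mul, ← hvar]
    simp only [integral_const, probReal_univ, one_smul, mul_zero, Complex.ofReal_zero, zero_mul,
      add_zero]
    push_cast
    ring
  rw [charFun_map_eq_integral hX, ← htaylor, ← integral_sub hexp (by exact hre.add him), hvar,
    ← integral_const_mul]
  refine norm_integral_le_of_norm_le (hX2.const_mul _) ?_
  filter_upwards [hXb] with ω hω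
  have hsX : |s * X ω| ≤ 1 := by
    rw [abs_mul]
    exact (mul_le_mul_of_nonneg_left hω (abs_nonneg s)).trans hs
  calc _ = ‖Complex.exp ((s * X ω : ℝ) * Complex.I)
          - (1 + (s * X ω : ℝ) * Complex.I - (s * X ω : ℝ) ^ 2 / 2)‖ := by
        congr 2
        push_cast
        ring
    _ ≤ |s * X ω| ^ 3 := norm_exp_mul_I_sub_taylor_le hsX
    _ = |X ω| * (|s| ^ 3 * X ω ^ 2) := by rw [abs_mul, ← sq_abs (X ω)]; ring
    _ ≤ b * (|s| ^ 3 * X ω ^ 2) := by gcongr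
    _ = b * |s| ^ 3 * X ω ^ 2 := by ring

theorem variance_le_sq_of_abs_le {X : Ω → ℝ} {b : ℝ} (hX : AEMeasurable X μ)
    (hXb : ∀ᵐ ω ∂μ, |X ω| ≤ b) : Var[X; μ] ≤ b ^ 2 := by
  have := variance_le_sq_of_bounded (hXb.mono fun ω h => abs_le.1 h) hX
  linarith [show ((b - -b) / 2) ^ 2 = b ^ 2 by ring]

theorem norm_charFun_sub_exp_le {X : Ω → ℝ} {b s : ℝ} (hX : AEMeasurable X μ)
    (hXb : ∀ᵐ ω ∂μ, |X ω| ≤ b) (hX0 : μ[X] = 0) (hs : |s| * b ≤ 1) :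
    ‖charFun (μ.map X) s - Real.exp (-(s ^ 2 * Var[X; μ] / 2))‖ ≤ 2 * b * |s| ^ 3 * Var[X; μ] := by
  have hb : 0 ≤ b := by
    obtain ⟨ω, hω⟩ := hXb.exists
    exact (abs_nonneg _).trans hω
  set V := Var[X; μ]
  have hV0 : 0 ≤ V := variance_nonneg X μ
  have hV : V ≤ b ^ 2 := variance_le_sq_of_abs_le hX hXb
  have hsV : s ^ 2 * V ≤ (|s| * b) ^ 2 := by
    rw [mul_pow, sq_abs]
    gcongr
  have hexp : ‖(1 - s ^ 2 * V / 2 : ℝ) - Real.exp (-(s ^ 2 * V / 2))‖ ≤ b * |s| ^ 3 * V := by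
    have hw : |(-(s ^ 2 * V / 2))| ≤ 1 := by
      rw [abs_neg, abs_of_nonneg (by positivity)]
      nlinarith [pow_le_one₀ (n := 2) (by positivity) hs]
    rw [norm_sub_rev, Real.norm_eq_abs]
    calc |Real.exp (-(s ^ 2 * V / 2)) - (1 - s ^ 2 * V / 2)|
        = |Real.exp (-(s ^ 2 * V / 2)) - 1 - -(s ^ 2 * V / 2)| := by congr 1; ring
      _ ≤ (-(s ^ 2 * V / 2)) ^ 2 := Real.abs_exp_sub_one_sub_id_le hw
      _ ≤ s ^ 2 * V * (s ^ 2 * V) := by nlinarith [mul_nonneg (sq_nonneg s) hV0]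
      _ ≤ s ^ 2 * V * (|s| * b * 1) := by
          refine mul_le_mul_of_nonneg_left (hsV.trans ?_) (by positivity)
          rw [sq]
          gcongr
      _ = b * |s| ^ 3 * V := by rw [← sq_abs s]; ring
  calc ‖charFun (μ.map X) s - Real.exp (-(s ^ 2 * V / 2))‖
      ≤ ‖charFun (μ.map X) s - (1 - s ^ 2 * V / 2 : ℝ)‖
        + ‖((1 - s ^ 2 * V / 2 : ℝ) : ℂ) - Real.exp (-(s ^ 2 * V / 2))‖ :=
        norm_sub_le_norm_sub_add_norm_sub _ _ _
    _ ≤ b * |s| ^ 3 * V + b * |s| ^ 3 * V := by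
        refine add_le_add (norm_charFun_sub_taylor_le hX hXb hX0 hs) ?_
        rwa [← Complex.ofReal_sub, Complex.norm_real]
    _ = 2 * b * |s| ^ 3 * V := by ring

theorem norm_charFun_sum_sub_exp_le {ι : Type*} {X : ι → Ω → ℝ} {S : Finset ι} {b s : ℝ}
    (hX : ∀ i ∈ S, AEMeasurable (X i) μ) (hind : iIndepFun (S.restrict X) μ)
    (hXb : ∀ i ∈ S, ∀ᵐ ω ∂μ, |X i ω| ≤ b) (hX0 : ∀ i ∈ S, μ[X i] = 0) (hs : |s| * b ≤ 1) :
    ‖charFun (μ.map fun ω => ∑ i ∈ S, X i ω) s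
        - Real.exp (-(s ^ 2 * (∑ i ∈ S, Var[X i; μ]) / 2))‖
      ≤ 2 * b * |s| ^ 3 * ∑ i ∈ S, Var[X i; μ] := by
  have hexp : (Real.exp (-(s ^ 2 * (∑ i ∈ S, Var[X i; μ]) / 2)) : ℂ)
      = ∏ i ∈ S, (Real.exp (-(s ^ 2 * Var[X i; μ] / 2)) : ℂ) := by
    rw [Finset.mul_sum, Finset.sum_div, ← Finset.sum_neg_distrib, Real.exp_sum]
    push_cast
    rfl
  rw [hind.charFun_map_fun_finsetSum_eq_prod hX, hexp, Finset.mul_sum, Finset.prod_apply]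
  refine (norm_prod_sub_prod_le_sum S (fun i hi => ?_) fun i _ => ?_).trans
    (Finset.sum_le_sum fun i hi => norm_charFun_sub_exp_le (hX i hi) (hXb i hi) (hX0 i hi) hs)
  · have := Measure.isProbabilityMeasure_map (hX i hi)
    exact norm_charFun_le_one s
  · rw [Complex.norm_real, Real.norm_of_nonneg (Real.exp_pos _).le, Real.exp_le_one_iff,
      Left.neg_nonpos_iff]
    have := variance_nonneg (X i) μ
    positivity

end CentralLimit

theorem tendsto_charFun_sum_div {α : Type*} {l : Filter α} {Ω : α → Type*}
    {mΩ : ∀ n, MeasurableSpace (Ω n)} {μ : ∀ n, Measure (Ω n)} [∀ n, IsProbabilityMeasure (μ n)]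
    {ι : Type*} {X : ∀ n, ι → Ω n → ℝ} {S : α → Finset ι} {b σ : α → ℝ}
    (hX : ∀ n, ∀ i ∈ S n, AEMeasurable (X n i) (μ n))
    (hind : ∀ n, iIndepFun ((S n).restrict (X n)) (μ n))
    (hXb : ∀ n, ∀ i ∈ S n, ∀ᵐ ω ∂μ n, |X n i ω| ≤ b n) (hX0 : ∀ n, ∀ i ∈ S n, (μ n)[X n i] = 0)
    (hvar : ∀ n, ∑ i ∈ S n, Var[X n i; μ n] = σ n ^ 2) (hσ : ∀ᶠ n in l, 0 < σ n)
    (hb : Tendsto (fun n => b n / σ n) l (𝓝 0)) (s : ℝ) :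
    Tendsto (fun n => charFun ((μ n).map fun ω => ∑ i ∈ S n, X n i ω) (s / σ n)) l
      (𝓝 (Real.exp (-(s ^ 2 / 2)))) := by
  rw [tendsto_iff_norm_sub_tendsto_zero]
  refine squeeze_zero' (.of_forall fun n => norm_nonneg _) ?_
    (g := fun n => 2 * |s| ^ 3 * (b n / σ n)) (by simpa using hb.const_mul (2 * |s| ^ 3))
  have hsmall : ∀ᶠ n in l, |s| * (b n / σ n) < 1 :=
    (hb.const_mul |s|).eventually_lt_const (by simp)
  filter_upwards [hσ, hsmall] with n hn hsn
  have habs : |s / σ n| = |s| / σ n := by rw [abs_div, abs_of_pos hn]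
  have h := norm_charFun_sum_sub_exp_le (hX n) (hind n) (hXb n) (hX0 n) (s := s / σ n)
    (by rw [habs, div_mul_eq_mul_div, mul_div_assoc]; exact hsn.le)
  rw [hvar, habs, ← mul_pow, div_mul_cancel₀ _ hn.ne'] at h
  refine h.trans_eq ?_
  field_simp

theorem tendsto_measureReal_Iic_of_tendsto_charFun {μ : ℕ → Measure ℝ}
    [∀ n, IsProbabilityMeasure (μ n)] {ν : Measure ℝ} [IsProbabilityMeasure ν]
    (h : ∀ s, Tendsto (fun n => charFun (μ n) s) atTop (𝓝 (charFun ν s))) {v : ℝ}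
    (hv : ν {v} = 0) :
    Tendsto (fun n => (μ n).real (Set.Iic v)) atTop (𝓝 (ν.real (Set.Iic v))) := by
  let P : ℕ → ProbabilityMeasure ℝ := fun n => ⟨μ n, inferInstance⟩
  let Q : ProbabilityMeasure ℝ := ⟨ν, inferInstance⟩
  have hlim : Tendsto P atTop (𝓝 Q) := ProbabilityMeasure.tendsto_iff_tendsto_charFun.2 h
  have hfr : Q (frontier (Set.Iic v)) = 0 := by
    rwa [frontier_Iic, ProbabilityMeasure.null_iff_toMeasure_null]
  exact (NNReal.continuous_coe.tendsto _).comp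
    (ProbabilityMeasure.tendsto_measure_of_null_frontier_of_tendsto hlim hfr)

theorem gaussianReal_real_Iic (v : ℝ) : (gaussianReal 0 1).real (Set.Iic v)
    = 1 / √(2 * Real.pi) * ∫ u in Set.Iic v, Real.exp (-(u ^ 2) / 2) := by
  rw [measureReal_def, gaussianReal_apply_eq_integral 0 one_ne_zero, ENNReal.toReal_ofReal
    (integral_nonneg fun u => gaussianPDFReal_nonneg 0 1 u), ← integral_const_mul]
  simp [gaussianPDFReal]

theorem charFun_gaussianReal_zero_one (s : ℝ) :
    charFun (gaussianReal 0 1) s = Real.exp (-(s ^ 2 / 2)) := by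
  rw [charFun_gaussianReal]
  push_cast
  congr 1
  ring

theorem tendsto_measureReal_div_le {Ω : ℕ → Type*} {mΩ : ∀ n, MeasurableSpace (Ω n)}
    {μ : ∀ n, Measure (Ω n)} [∀ n, IsProbabilityMeasure (μ n)] {Y : ∀ n, Ω n → ℝ} {σ : ℕ → ℝ}
    (hY : ∀ n, Measurable (Y n))
    (h : ∀ s, Tendsto (fun n => charFun ((μ n).map (Y n)) (s / σ n)) atTop
      (𝓝 (Real.exp (-(s ^ 2 / 2))))) (v : ℝ) :
    Tendsto (fun n => (μ n).real {ω | Y n ω / σ n ≤ v}) atTop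
      (𝓝 (1 / √(2 * Real.pi) * ∫ u in Set.Iic v, Real.exp (-(u ^ 2) / 2))) := by
  have hdiv (n : ℕ) : Measurable fun ω => (σ n)⁻¹ * Y n ω := (hY n).const_mul _
  have (n : ℕ) := Measure.isProbabilityMeasure_map (μ := μ n) (hdiv n).aemeasurable
  have : NullSingletonClass (gaussianReal 0 1) := nullSingletonClass_gaussianReal one_ne_zero
  have hlim := tendsto_measureReal_Iic_of_tendsto_charFun
    (μ := fun n => (μ n).map fun ω => (σ n)⁻¹ * Y n ω) (ν := gaussianReal 0 1) (fun s => by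
      simpa only [charFun_map_mul_comp (hY _).aemeasurable, charFun_gaussianReal_zero_one,
        div_eq_inv_mul] using h s) (measure_singleton v)
  rw [gaussianReal_real_Iic] at hlim
  refine hlim.congr fun n => ?_
  rw [map_measureReal_apply (hdiv n) measurableSet_Iic]
  simp only [Set.preimage, Set.mem_Iic, div_eq_inv_mul]

theorem integral_exp_int_mul_I (m : ℤ) :
    ∫ θ in (-Real.pi)..Real.pi, Complex.exp ((θ * m : ℝ) * Complex.I)
      = if m = 0 then 2 * (Real.pi : ℂ) else 0 := by
  split_ifs with h
  · subst h
    simp only [Int.cast_zero, mul_zero, Complex.ofReal_zero, zero_mul, Complex.exp_zero,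
      intervalIntegral.integral_const, sub_neg_eq_add, Complex.real_smul, Complex.ofReal_add,
      mul_one]
    ring
  · have hc : (m : ℂ) * Complex.I ≠ 0 := mul_ne_zero (by exact_mod_cast h) Complex.I_ne_zero
    have harg : ∀ θ : ℝ, ((θ * m : ℝ) : ℂ) * Complex.I = (m * Complex.I) * θ := by
      intro θ; push_cast; ring
    simp_rw [harg]
    have hperiod : Complex.exp (m * Complex.I * Real.pi)
        = Complex.exp (m * Complex.I * (-Real.pi : ℝ)) :=
      Complex.exp_eq_exp_iff_exists_int.2 ⟨m, by push_cast; ring⟩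
    rw [integral_exp_mul_complex hc, hperiod, sub_self, zero_div]

theorem integral_charFun_map_int {Ω : Type*} {mΩ : MeasurableSpace Ω} {μ : Measure Ω}
    [IsFiniteMeasure μ] {Z : Ω → ℤ} (hZ : Measurable Z) :
    ∫ θ in (-Real.pi)..Real.pi, charFun (μ.map fun ω => (Z ω : ℝ)) θ
      = (2 * Real.pi * μ.real {ω | Z ω = 0} : ℝ) := by
  have hZr : Measurable fun ω => (Z ω : ℝ) := measurable_from_top.comp hZ
  have : IsFiniteMeasure (volume.restrict (Set.uIoc (-Real.pi) Real.pi)) :=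
    isFiniteMeasure_restrict.2 (by simp [Set.uIoc])
  have hmeas : Measurable fun p : ℝ × Ω => Complex.exp ((p.1 * Z p.2 : ℝ) * Complex.I) := by
    have : Measurable fun p : ℝ × Ω => (Z p.2 : ℝ) := hZr.comp measurable_snd
    fun_prop
  have hint : Integrable (Function.uncurry fun (θ : ℝ) ω => Complex.exp ((θ * Z ω : ℝ) * Complex.I))
      ((volume.restrict (Set.uIoc (-Real.pi) Real.pi)).prod μ) :=
    .of_bound hmeas.aestronglyMeasurable 1
      (.of_forall fun _ => (Complex.norm_exp_ofReal_mul_I _).le)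
  simp_rw [charFun_map_eq_integral hZr.aemeasurable]
  rw [intervalIntegral_integral_swap hint]
  simp_rw [integral_exp_int_mul_I]
  have hind : ∀ ω, (if Z ω = 0 then 2 * (Real.pi : ℂ) else 0)
      = {ω | Z ω = 0}.indicator (fun _ => 2 * (Real.pi : ℂ)) ω := fun ω => by
    simp [Set.indicator_apply]
  simp_rw [hind]
  have hzero : MeasurableSet {ω | Z ω = 0} := hZ (measurableSet_singleton 0)
  rw [integral_indicator_const _ hzero, Complex.real_smul]
  push_cast
  ring

theorem integral_exp_neg_sq_div_two :
    ∫ s : ℝ, (Real.exp (-(s ^ 2 / 2)) : ℂ) = (√(2 * Real.pi) : ℝ) := by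
  rw [integral_complex_ofReal, show 2 * Real.pi = Real.pi / (1 / 2) by ring,
    ← integral_gaussian (1 / 2)]
  congr 3 with s
  ring_nf

theorem tendsto_intervalIntegral_charFun {μ : ℕ → Measure ℝ} [∀ n, IsFiniteMeasure (μ n)]
    {σ : ℕ → ℝ} {g : ℝ → ℝ} (hσ : Tendsto σ atTop atTop) (hg : Integrable g)
    (hbound : ∀ᶠ n in atTop, ∀ s, |s| ≤ Real.pi * σ n → ‖charFun (μ n) (s / σ n)‖ ≤ g s)
    (h : ∀ s, Tendsto (fun n => charFun (μ n) (s / σ n)) atTop (𝓝 (Real.exp (-(s ^ 2 / 2))))) :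
    Tendsto (fun n => ∫ s in (-(Real.pi * σ n))..(Real.pi * σ n), charFun (μ n) (s / σ n)) atTop
      (𝓝 (√(2 * Real.pi) : ℝ)) := by
  have hwide (s : ℝ) : ∀ᶠ n in atTop, |s| < Real.pi * σ n :=
    (hσ.const_mul_atTop Real.pi_pos).eventually_gt_atTop |s|
  have hg0 (s : ℝ) : 0 ≤ g s := by
    obtain ⟨n, hn, hs⟩ := (hbound.and (hwide s)).exists
    exact (norm_nonneg _).trans (hn s hs.le)
  have hlim : Tendsto (fun n => ∫ s, (Set.Ioc (-(Real.pi * σ n)) (Real.pi * σ n)).indicator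
      (fun s => charFun (μ n) (s / σ n)) s) atTop (𝓝 (√(2 * Real.pi) : ℝ)) := by
    rw [← integral_exp_neg_sq_div_two]
    refine tendsto_integral_filter_of_dominated_convergence g ?_ ?_ hg ?_
    · exact .of_forall fun n => ((measurable_charFun.comp
        (measurable_id.div_const _)).indicator measurableSet_Ioc).aestronglyMeasurable
    · filter_upwards [hbound] with n hn
      refine .of_forall fun s => ?_
      by_cases hs : s ∈ Set.Ioc (-(Real.pi * σ n)) (Real.pi * σ n)
      · simpa [hs] using hn s (abs_le.2 ⟨hs.1.le, hs.2⟩)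
      · simpa [hs] using hg0 s
    · refine .of_forall fun s => (h s).congr' ?_
      filter_upwards [hwide s] with n hn
      rw [Set.indicator_of_mem (Set.Ioo_subset_Ioc_self (abs_lt.1 hn))]
  refine hlim.congr' ?_
  filter_upwards [hwide 0] with n hn
  rw [abs_zero] at hn
  rw [integral_indicator measurableSet_Ioc, intervalIntegral.integral_of_le (by linarith)]

theorem tendsto_mul_measureReal_eq_zero {Ω : ℕ → Type*} {mΩ : ∀ n, MeasurableSpace (Ω n)}
    {μ : ∀ n, Measure (Ω n)} [∀ n, IsFiniteMeasure (μ n)] {Z : ∀ n, Ω n → ℤ} {σ : ℕ → ℝ}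
    {g : ℝ → ℝ} (hZ : ∀ n, Measurable (Z n)) (hσ : Tendsto σ atTop atTop) (hg : Integrable g)
    (hbound : ∀ᶠ n in atTop, ∀ s, |s| ≤ Real.pi * σ n →
      ‖charFun ((μ n).map fun ω => (Z n ω : ℝ)) (s / σ n)‖ ≤ g s)
    (h : ∀ s, Tendsto (fun n => charFun ((μ n).map fun ω => (Z n ω : ℝ)) (s / σ n)) atTop
      (𝓝 (Real.exp (-(s ^ 2 / 2))))) :
    Tendsto (fun n => σ n * (μ n).real {ω | Z n ω = 0}) atTop (𝓝 (1 / √(2 * Real.pi))) := by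
  have hlim := ((Complex.continuous_re.tendsto _).comp
    (tendsto_intervalIntegral_charFun hσ hg hbound h)).div_const (2 * Real.pi)
  rw [Complex.ofReal_re, Real.sqrt_div_self'] at hlim
  refine hlim.congr' ?_
  filter_upwards [hσ.eventually_gt_atTop 0] with n hn
  rw [Function.comp_apply, intervalIntegral.integral_comp_div _ hn.ne', neg_div,
    mul_div_cancel_right₀ _ hn.ne', integral_charFun_map_int (hZ n), Complex.real_smul,
    ← Complex.ofReal_mul, Complex.ofReal_re]
  field_simp

theorem charFun_map_fun_add_const {Ω : Type*} {mΩ : MeasurableSpace Ω} {μ : Measure Ω} {X : Ω → ℝ}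
    (hX : AEMeasurable X μ) (c θ : ℝ) : charFun (μ.map fun ω => X ω + c) θ
      = charFun (μ.map X) θ * Complex.exp ((θ * c : ℝ) * Complex.I) := by
  have hmap : (μ.map fun ω => X ω + c) = (μ.map X).map (· + c) :=
    (AEMeasurable.map_map_of_aemeasurable (g := fun z => z + c) (by fun_prop) hX).symm
  rw [hmap, charFun_map_add_const, Real.inner_apply, mul_comm c]

theorem tendsto_charFun_map_add_of_isLittleO {α : Type*} {l : Filter α} {Ω : α → Type*}
    {mΩ : ∀ n, MeasurableSpace (Ω n)} {μ : ∀ n, Measure (Ω n)} {Y : ∀ n, Ω n → ℝ} {c σ : α → ℝ}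
    (hY : ∀ n, AEMeasurable (Y n) (μ n)) (hc : c =o[l] σ) {s : ℝ} {L : ℂ}
    (h : Tendsto (fun n => charFun ((μ n).map (Y n)) (s / σ n)) l (𝓝 L)) :
    Tendsto (fun n => charFun ((μ n).map fun ω => Y n ω + c n) (s / σ n)) l (𝓝 L) := by
  have hphase : Tendsto (fun n => Complex.exp ((s / σ n * c n : ℝ) * Complex.I)) l (𝓝 1) := by
    have hcont : Continuous fun y : ℝ => Complex.exp ((s * y : ℝ) * Complex.I) := by fun_prop
    have hlim := (hcont.tendsto 0).comp hc.tendsto_div_nhds_zero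
    rw [mul_zero, Complex.ofReal_zero, zero_mul, Complex.exp_zero] at hlim
    refine hlim.congr fun n => ?_
    rw [Function.comp_apply, div_mul_eq_mul_div, mul_div_assoc]
  simpa only [charFun_map_fun_add_const (hY _), mul_one] using h.mul hphase

theorem norm_one_sub_add_mul_exp_sq (p θ : ℝ) :
    ‖(1 - p : ℂ) + p * Complex.exp (θ * Complex.I)‖ ^ 2
      = 1 - 2 * (p * (1 - p)) * (1 - Real.cos θ) := by
  rw [← Complex.normSq_eq_norm_sq, Complex.normSq_apply]
  simp only [Complex.add_re, Complex.sub_re, Complex.one_re, Complex.ofReal_re,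
    Complex.re_ofReal_mul, Complex.exp_ofReal_mul_I_re, Complex.add_im, Complex.sub_im,
    Complex.one_im, Complex.ofReal_im, Complex.im_ofReal_mul, Complex.exp_ofReal_mul_I_im,
    sub_self, zero_add]
  linear_combination p ^ 2 * Real.sin_sq_add_cos_sq θ

theorem charFun_map_of_ae_eq_zero_or_one {Ω : Type*} {mΩ : MeasurableSpace Ω} {μ : Measure Ω}
    [IsProbabilityMeasure μ] {X : Ω → ℝ} (hX : AEMeasurable X μ)
    (h01 : ∀ᵐ ω ∂μ, X ω = 0 ∨ X ω = 1) (θ : ℝ) :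
    charFun (μ.map X) θ = (1 - (μ[X] : ℝ)) + (μ[X] : ℝ) * Complex.exp (θ * Complex.I) := by
  have hint : Integrable X μ := .of_bound hX.aestronglyMeasurable 1 (h01.mono fun ω h => by
    rcases h with h | h <;> simp [h])
  have hexp : (fun ω => Complex.exp ((θ * X ω : ℝ) * Complex.I))
      =ᵐ[μ] fun ω => 1 + (X ω : ℂ) * (Complex.exp (θ * Complex.I) - 1) := by
    filter_upwards [h01] with ω h
    rcases h with h | h <;> simp [h]
  have hofReal : Integrable (fun ω => (X ω : ℂ)) μ := hint.ofReal
  rw [charFun_map_eq_integral hX, integral_congr_ae hexp,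
    integral_add (integrable_const _) (hofReal.mul_const _), integral_mul_const,
    integral_complex_ofReal]
  simp only [integral_const, probReal_univ, one_smul]
  ring

theorem variance_eq_mul_of_ae_eq_zero_or_one {Ω : Type*} {mΩ : MeasurableSpace Ω} {μ : Measure Ω}
    [IsProbabilityMeasure μ] {X : Ω → ℝ} (hX : AEMeasurable X μ)
    (h01 : ∀ᵐ ω ∂μ, X ω = 0 ∨ X ω = 1) : Var[X; μ] = μ[X] * (1 - μ[X]) := by
  have hLp : MemLp X 2 μ := .of_bound hX.aestronglyMeasurable 1 (h01.mono fun ω h => by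
    rcases h with h | h <;> simp [h])
  have hsq : X ^ 2 =ᵐ[μ] X := h01.mono fun ω h => by rcases h with h | h <;> simp [h]
  rw [variance_eq_sub hLp, integral_congr_ae hsq]
  ring

theorem norm_charFun_map_le_of_ae_eq_zero_or_one {Ω : Type*} {mΩ : MeasurableSpace Ω}
    {μ : Measure Ω} [IsProbabilityMeasure μ] {X : Ω → ℝ} (hX : AEMeasurable X μ)
    (h01 : ∀ᵐ ω ∂μ, X ω = 0 ∨ X ω = 1) (θ : ℝ) :
    ‖charFun (μ.map X) θ‖ ≤ Real.exp (-(Var[X; μ] * (1 - Real.cos θ))) := by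
  refine le_of_sq_le_sq ?_ (Real.exp_pos _).le
  rw [charFun_map_of_ae_eq_zero_or_one hX h01, norm_one_sub_add_mul_exp_sq, ← Real.exp_nat_mul,
    variance_eq_mul_of_ae_eq_zero_or_one hX h01]
  refine le_trans (le_of_eq ?_) (Real.add_one_le_exp _)
  push_cast
  ring

theorem half_le_sum_one_sub_cos {θ : ℝ} {M : ℕ} (hθ : |θ| ≤ Real.pi) (hM : Real.pi ≤ M * |θ|) :
    (M : ℝ) / 2 ≤ ∑ k ∈ Finset.Icc 1 M, (1 - Real.cos (k * θ)) := by
  wlog h0 : 0 ≤ θ generalizing θ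
  · simpa using this (θ := -θ) (by rwa [abs_neg]) (by rwa [abs_neg]) (by linarith)
  rw [abs_of_nonneg h0] at hθ hM
  have hsin : θ / Real.pi ≤ Real.sin (θ / 2) := by
    convert Real.mul_le_sin (x := θ / 2) (by positivity) (by linarith) using 1
    ring
  have hMsin : 1 ≤ M * Real.sin (θ / 2) :=
    calc 1 ≤ M * θ / Real.pi := by rwa [one_le_div Real.pi_pos]
      _ = M * (θ / Real.pi) := by ring
      _ ≤ M * Real.sin (θ / 2) := by gcongr
  have hsin0 : 0 < Real.sin (θ / 2) := pos_of_mul_pos_right (one_pos.trans_le hMsin) M.cast_nonneg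
  have hdirichlet : Real.sin (θ / 2) * ∑ k ∈ Finset.Icc 1 M, Real.cos (k * θ)
      = Real.sin (M * θ / 2) * Real.cos ((M + 1) * θ / 2) := by
    rw [← Finset.Ico_add_one_right_eq_Icc, Finset.sum_Ico_eq_sum_range]
    convert Real.sin_mul_sum_cos M θ θ using 4
    · simp
    · push_cast; ring
    · ring
  have hcos : ∑ k ∈ Finset.Icc 1 M, Real.cos (k * θ) ≤ M / 2 := by
    refine le_of_mul_le_mul_left ?_ hsin0
    rw [hdirichlet]
    have hprod : 2 * (Real.sin (M * θ / 2) * Real.cos ((M + 1) * θ / 2))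
        = Real.sin ((M + 1) * θ / 2 + M * θ / 2) - Real.sin (θ / 2) := by
      rw [show θ / 2 = (M + 1) * θ / 2 - M * θ / 2 by ring, Real.sin_add, Real.sin_sub]
      ring
    linarith [Real.sin_le_one ((M + 1) * θ / 2 + M * θ / 2)]
  rw [Finset.sum_sub_distrib, Finset.sum_const, Nat.card_Icc, add_tsub_cancel_right, nsmul_one]
  linarith

theorem mul_sum_sq_le_sum_one_sub_cos {θ : ℝ} {M : ℕ} (hM : M * |θ| ≤ Real.pi) :
    2 / Real.pi ^ 2 * θ ^ 2 * ∑ k ∈ Finset.Icc 1 M, (k : ℝ) ^ 2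
      ≤ ∑ k ∈ Finset.Icc 1 M, (1 - Real.cos (k * θ)) := by
  rw [Finset.mul_sum]
  refine Finset.sum_le_sum fun k hk => ?_
  have hkM : (k : ℝ) ≤ M := by exact_mod_cast (Finset.mem_Icc.1 hk).2
  have habs : |(k : ℝ) * θ| ≤ Real.pi := by
    rw [abs_mul, Nat.abs_cast]
    exact (mul_le_mul_of_nonneg_right hkM (abs_nonneg θ)).trans hM
  have := Real.cos_le_one_sub_mul_cos_sq habs
  linarith [mul_pow (k : ℝ) θ 2]

theorem cube_div_three_le_sum_sq (M : ℕ) :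
    (M : ℝ) ^ 3 / 3 ≤ ∑ k ∈ Finset.Icc 1 M, (k : ℝ) ^ 2 := by
  induction M with
  | zero => simp
  | succ M ih =>
    rw [Finset.sum_Icc_succ_top (by lia)]
    push_cast
    nlinarith [M.cast_nonneg (α := ℝ)]

theorem sum_sq_le_cube (M : ℕ) : ∑ k ∈ Finset.Icc 1 M, (k : ℝ) ^ 2 ≤ (M : ℝ) ^ 3 := by
  refine (Finset.sum_le_card_nsmul _ _ ((M : ℝ) ^ 2) fun k hk => ?_).trans (le_of_eq ?_)
  · have : (k : ℝ) ≤ M := by exact_mod_cast (Finset.mem_Icc.1 hk).2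
    gcongr
  · rw [Nat.card_Icc, add_tsub_cancel_right, nsmul_eq_mul]
    ring

theorem sq_le_mul_exp_sum_one_sub_cos {c σ s : ℝ} {M : ℕ} (hc : 0 < c) (hσ : 0 < σ)
    (hσM : σ ^ 2 ≤ ∑ k ∈ Finset.Icc 1 M, (k : ℝ) ^ 2) (hs : |s| ≤ Real.pi * σ) :
    s ^ 2 ≤ (48 * Real.pi ^ 2 / c ^ 3 + Real.pi ^ 2 / (2 * c))
      * Real.exp (c * ∑ k ∈ Finset.Icc 1 M, (1 - Real.cos (k * (s / σ)))) := by
  have hθ : |s / σ| ≤ Real.pi := by rwa [abs_div, abs_of_pos hσ, div_le_iff₀ hσ]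
  set y := c * ∑ k ∈ Finset.Icc 1 M, (1 - Real.cos (k * (s / σ)))
  rw [add_mul]
  rcases le_total Real.pi (M * |s / σ|) with h | h
  · refine le_add_of_le_of_nonneg ?_ (by positivity)
    have hy : c * (M / 2) ≤ y := mul_le_mul_of_nonneg_left (half_le_sum_one_sub_cos hθ h) hc.le
    calc s ^ 2 = |s| ^ 2 := (sq_abs s).symm
      _ ≤ (Real.pi * σ) ^ 2 := by gcongr
      _ = Real.pi ^ 2 * σ ^ 2 := by ring
      _ ≤ Real.pi ^ 2 * M ^ 3 := by gcongr; exact hσM.trans (sum_sq_le_cube M)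
      _ = 48 * Real.pi ^ 2 / c ^ 3 * ((c * (M / 2)) ^ 3 / (Nat.factorial 3 : ℝ)) := by
        norm_num [Nat.factorial]
        field_simp
        ring
      _ ≤ 48 * Real.pi ^ 2 / c ^ 3 * Real.exp (c * (M / 2)) := by
        gcongr
        exact Real.pow_div_factorial_le_exp _ (by positivity) 3
      _ ≤ 48 * Real.pi ^ 2 / c ^ 3 * Real.exp y := by gcongr
  · refine le_add_of_nonneg_of_le (by positivity) ?_
    have hy : c * (2 / Real.pi ^ 2 * s ^ 2) ≤ y := by
      refine mul_le_mul_of_nonneg_left (le_trans ?_ (mul_sum_sq_le_sum_one_sub_cos h)) hc.le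
      calc 2 / Real.pi ^ 2 * s ^ 2 = 2 / Real.pi ^ 2 * (s / σ) ^ 2 * σ ^ 2 := by
            field_simp
        _ ≤ _ := by gcongr
    calc s ^ 2 = Real.pi ^ 2 / (2 * c) * (c * (2 / Real.pi ^ 2 * s ^ 2)) := by field_simp
      _ ≤ Real.pi ^ 2 / (2 * c) * Real.exp y := by
        gcongr
        linarith [Real.add_one_le_exp y]

theorem exp_neg_mul_sum_one_sub_cos_le {c σ s : ℝ} {M : ℕ} (hc : 0 < c) (hσ : 0 < σ)
    (hσM : σ ^ 2 ≤ ∑ k ∈ Finset.Icc 1 M, (k : ℝ) ^ 2) (hs : |s| ≤ Real.pi * σ) :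
    Real.exp (-(c * ∑ k ∈ Finset.Icc 1 M, (1 - Real.cos (k * (s / σ)))))
      ≤ (1 + (48 * Real.pi ^ 2 / c ^ 3 + Real.pi ^ 2 / (2 * c))) * (1 + s ^ 2)⁻¹ := by
  have hsq := sq_le_mul_exp_sum_one_sub_cos hc hσ hσM hs
  set y := c * ∑ k ∈ Finset.Icc 1 M, (1 - Real.cos (k * (s / σ)))
  have hy : 0 ≤ y :=
    mul_nonneg hc.le (Finset.sum_nonneg fun k _ => sub_nonneg.2 (Real.cos_le_one _))
  rw [← div_eq_mul_inv, le_div_iff₀ (by positivity), Real.exp_neg,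
    inv_mul_le_iff₀ (Real.exp_pos y)]
  linarith [Real.one_le_exp hy]

theorem abs_mul_sub_integral_le {g : ℝ → ℝ} {a b : ℝ} {K : ℝ≥0} (hab : a ≤ b)
    (hg : LipschitzOnWith K g (Set.Icc a b)) :
    |(b - a) * g b - ∫ u in a..b, g u| ≤ K * (b - a) ^ 2 := by
  have hint : IntervalIntegrable g volume a b :=
    hg.continuousOn.intervalIntegrable_of_Icc hab
  rw [← smul_eq_mul, ← intervalIntegral.integral_const,
    ← intervalIntegral.integral_sub intervalIntegrable_const hint]
  have hbound : ∀ u ∈ Set.uIoc a b, ‖g b - g u‖ ≤ K * (b - a) := by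
    intro u hu
    rw [Set.uIoc_of_le hab] at hu
    refine (hg.dist_le_mul b (Set.right_mem_Icc.2 hab) u (Set.Ioc_subset_Icc_self hu)).trans ?_
    rw [Real.dist_eq, abs_of_nonneg (sub_nonneg.2 hu.2)]
    gcongr
    exact hu.1.le
  refine (intervalIntegral.norm_integral_le_of_norm_le_const hbound).trans_eq ?_
  rw [abs_of_nonneg (sub_nonneg.2 hab)]
  ring

theorem abs_sum_mul_sub_integral_le {g : ℝ → ℝ} {h : ℝ} {K : ℝ≥0} {M : ℕ} (hh : 0 ≤ h)
    (hg : LipschitzOnWith K g (Set.Icc 0 (M * h))) :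
    |∑ k ∈ Finset.Icc 1 M, h * g (k * h) - ∫ u in (0 : ℝ)..(M * h), g u| ≤ K * (M * h) * h := by
  induction M with
  | zero => simp
  | succ M ih =>
    have hle : (M : ℝ) * h ≤ (M + 1 : ℕ) * h := by gcongr; lia
    have hM : 0 ≤ M * h := by positivity
    have hcell := abs_mul_sub_integral_le hle (hg.mono (Set.Icc_subset_Icc_left hM))
    have hlen : ((M + 1 : ℕ) : ℝ) * h - M * h = h := by push_cast; ring
    rw [hlen] at hcell
    have hadd := intervalIntegral.integral_add_adjacent_intervals
      ((hg.mono (Set.Icc_subset_Icc_right hle)).continuousOn.intervalIntegrable_of_Icc hM)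
      ((hg.mono (Set.Icc_subset_Icc_left hM)).continuousOn.intervalIntegrable_of_Icc
        (μ := volume) hle)
    rw [Finset.sum_Icc_succ_top (by lia), ← hadd, add_sub_add_comm]
    refine (abs_add_le _ _).trans
      ((add_le_add (ih (hg.mono (Set.Icc_subset_Icc_right hle))) hcell).trans_eq ?_)
    push_cast
    ring

theorem abs_riemannSum_sub_integral_le {g : ℝ → ℝ} {t C h : ℝ} {K : ℝ≥0} {M : ℕ}
    (hg : LipschitzOnWith K g (Set.Icc 0 t)) (hC : ∀ u ∈ Set.Icc 0 t, |g u| ≤ C) (hh : 0 ≤ h)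
    (hM : M * h ≤ t) (hM' : t ≤ (M + 1) * h) :
    |∑ k ∈ Finset.Icc 1 M, h * g (k * h) - ∫ u in (0 : ℝ)..t, g u| ≤ (K * t + C) * h := by
  have hM0 : 0 ≤ M * h := by positivity
  have hC0 : 0 ≤ C := (abs_nonneg _).trans (hC t ⟨hM0.trans hM, le_rfl⟩)
  have hbulk := abs_sum_mul_sub_integral_le hh (hg.mono (Set.Icc_subset_Icc_right hM))
  have htail : |∫ u in (M * h)..t, g u| ≤ C * h := by
    refine (intervalIntegral.norm_integral_le_of_norm_le_const (f := g) (C := C)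
      fun u hu => ?_).trans ?_
    · rw [Set.uIoc_of_le hM] at hu
      exact hC u ⟨hM0.trans hu.1.le, hu.2⟩
    · rw [abs_of_nonneg (sub_nonneg.2 hM)]
      gcongr
      linarith
  have hadd := intervalIntegral.integral_add_adjacent_intervals
    ((hg.mono (Set.Icc_subset_Icc_right hM)).continuousOn.intervalIntegrable_of_Icc hM0)
    ((hg.mono (Set.Icc_subset_Icc_left hM0)).continuousOn.intervalIntegrable_of_Icc
      (μ := volume) hM)
  rw [← hadd, ← sub_sub]
  calc _ ≤ K * (M * h) * h + C * h := (abs_sub _ _).trans (add_le_add hbulk htail)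
    _ ≤ K * t * h + C * h := by gcongr
    _ = (K * t + C) * h := by ring

namespace DistinctParts

/-- The probability under `P_{x,n}` that `k` is a part. -/
noncomputable def prob (x : ℝ) (k : ℕ) : ℝ := x ^ k / (1 + x ^ k)

theorem prob_nonneg {x : ℝ} (hx : 0 ≤ x) (k : ℕ) : 0 ≤ prob x k := by
  unfold prob; positivity

theorem one_sub_prob {x : ℝ} (hx : 0 ≤ x) (k : ℕ) : 1 - prob x k = (1 + x ^ k)⁻¹ := by
  unfold prob
  field_simp
  ring

theorem prob_le_one {x : ℝ} (hx : 0 ≤ x) (k : ℕ) : prob x k ≤ 1 := by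
  rw [← sub_nonneg, one_sub_prob hx]
  positivity

theorem prob_mul_one_sub_prob {x : ℝ} (hx : 0 ≤ x) (k : ℕ) :
    prob x k * (1 - prob x k) = x ^ k / (1 + x ^ k) ^ 2 := by
  rw [one_sub_prob hx, prob]
  field_simp

theorem genPoly_pos (t : ℝ) (n : ℕ) {x : ℝ} (hx : 0 ≤ x) : 0 < genPoly t n x :=
  Finset.prod_pos fun k _ => by positivity

section Boltzmann

variable {t : ℝ} {n : ℕ} {x : ℝ}

theorem mult_eq_zero_or_one (k : ℕ) (l : Part t n) : (mult k l : ℝ) = 0 ∨ (mult k l : ℝ) = 1 := by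
  unfold mult
  split_ifs <;> simp

theorem integral_boltzmann {E : Type*} [NormedAddCommGroup E] [NormedSpace ℝ E] [CompleteSpace E]
    (hx : 0 ≤ x) (f : Part t n → E) :
    ∫ l, f l ∂boltzmann t n x = ∑ l, (x ^ l.size / genPoly t n x) • f l := by
  have hD := genPoly_pos t n hx
  unfold boltzmann
  rw [integral_finsetSum_measure fun l _ =>
    (integrable_dirac (by simp [enorm_lt_top])).smul_measure ENNReal.ofReal_ne_top]
  refine Finset.sum_congr rfl fun l _ => ?_
  rw [integral_smul_measure, integral_dirac, ENNReal.toReal_ofReal (by positivity)]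

theorem prod_mult {R : Type*} [CommMonoid R] (f : ℕ → ℕ → R) (l : Part t n) :
    ∏ k ∈ parts t n, f k (mult k l) = (∏ k ∈ l.1, f k 1) * ∏ k ∈ parts t n \ l.1, f k 0 := by
  rw [← Finset.prod_sdiff (Finset.mem_powerset.1 l.2), mul_comm]
  congr 1
  · exact Finset.prod_congr rfl fun k hk => by rw [mult, if_pos hk]
  · exact Finset.prod_congr rfl fun k hk => by rw [mult, if_neg (Finset.mem_sdiff.1 hk).2]

theorem integral_prod_mult {R : Type*} [NormedCommRing R] [NormedAlgebra ℝ R] [CompleteSpace R]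
    (hx : 0 ≤ x) (f : ℕ → ℕ → R) :
    ∫ l : Part t n, ∏ k ∈ parts t n, f k (mult k l) ∂boltzmann t n x
      = ∏ k ∈ parts t n, ((1 - prob x k) • f k 0 + prob x k • f k 1) := by
  have hfactor : ∀ k ∈ parts t n, (1 - prob x k) • f k 0 + prob x k • f k 1
      = (1 + x ^ k)⁻¹ • (x ^ k • f k 1 + f k 0) := fun k _ => by
    rw [one_sub_prob hx, prob, smul_add, smul_smul, div_eq_inv_mul, add_comm]
  have hterm : ∀ l : Part t n,
      (x ^ l.size / genPoly t n x) • ∏ k ∈ parts t n, f k (mult k l)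
        = (genPoly t n x)⁻¹ • ((∏ k ∈ l.1, x ^ k • f k 1) * ∏ k ∈ parts t n \ l.1, f k 0) := by
    intro l
    rw [prod_mult, Finset.prod_smul, Finset.prod_pow_eq_pow_sum, smul_mul_assoc, smul_smul,
      div_eq_inv_mul, Part.size]
  rw [integral_boltzmann hx, Finset.sum_congr rfl fun l _ => hterm l, ← Finset.smul_sum,
    Finset.prod_congr rfl hfactor, Finset.prod_smul, Finset.prod_inv_distrib, ← genPoly,
    Finset.prod_add]
  congr 1
  exact Finset.sum_coe_sort (parts t n).powerset
    fun A => (∏ k ∈ A, x ^ k • f k 1) * ∏ k ∈ parts t n \ A, f k 0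

theorem integral_comp_mult {R : Type*} [NormedCommRing R] [NormedAlgebra ℝ R] [CompleteSpace R]
    (hx : 0 ≤ x) (f : ℕ → R) {k : ℕ} (hk : k ∈ parts t n) :
    ∫ l : Part t n, f (mult k l) ∂boltzmann t n x = (1 - prob x k) • f 0 + prob x k • f 1 := by
  have hfactor : ∀ j, (1 - prob x j) • (if j = k then f 0 else 1)
      + prob x j • (if j = k then f 1 else 1)
      = if j = k then (1 - prob x k) • f 0 + prob x k • f 1 else 1 := fun j => by
    split_ifs with hj
    · rw [hj]
    · rw [← add_smul, sub_add_cancel, one_smul]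
  have h := integral_prod_mult (t := t) (n := n) hx fun j i => if j = k then f i else 1
  simpa only [hfactor, Finset.prod_ite_eq', if_pos hk] using h

theorem integral_mult (hx : 0 ≤ x) {k : ℕ} (hk : k ∈ parts t n) :
    ∫ l : Part t n, (mult k l : ℝ) ∂boltzmann t n x = prob x k := by
  simpa using integral_comp_mult hx (fun i => (i : ℝ)) hk

theorem iIndepFun_mult (hx : 0 < x) :
    iIndepFun ((parts t n).restrict fun k (l : Part t n) => (mult k l : ℝ)) (boltzmann t n x) := by
  have := isProbabilityMeasure_boltzmann t n hx
  rw [iIndepFun_iff_charFun_pi fun _ => Measurable.of_discrete.aemeasurable]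
  intro s
  set r : ℕ → ℝ := fun k => if h : k ∈ parts t n then s ⟨k, h⟩ else 0
  have hr : ∀ k : parts t n, s k = r k := fun k => by simp [r]
  have hinner : ∀ l : Part t n, Complex.exp
      ((inner ℝ (WithLp.toLp 2 fun k : parts t n => (mult (k : ℕ) l : ℝ)) s : ℝ) * Complex.I)
      = ∏ k ∈ parts t n, Complex.exp ((r k * mult k l : ℝ) * Complex.I) := fun l => by
    rw [← Complex.exp_sum, ← Finset.sum_mul, ← Finset.sum_coe_sort, PiLp.inner_apply]
    push_cast
    simp [hr]
  calc charFun _ s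
      = ∫ l : Part t n, ∏ k ∈ parts t n, Complex.exp ((r k * mult k l : ℝ) * Complex.I)
          ∂boltzmann t n x := by
        rw [charFun_apply, integral_map Measurable.of_discrete.aemeasurable (by fun_prop)]
        exact integral_congr_ae (.of_forall hinner)
    _ = ∏ k ∈ parts t n, ∫ l : Part t n, Complex.exp ((r k * mult k l : ℝ) * Complex.I)
          ∂boltzmann t n x := by
        rw [integral_prod_mult hx.le fun k i => Complex.exp ((r k * i : ℝ) * Complex.I)]
        exact Finset.prod_congr rfl fun k hk =>
          (integral_comp_mult hx.le (fun i => Complex.exp ((r k * i : ℝ) * Complex.I)) hk).symm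
    _ = ∏ k : parts t n, charFun ((boltzmann t n x).map fun l => (mult (k : ℕ) l : ℝ)) (s k) := by
        rw [← Finset.prod_coe_sort]
        exact Finset.prod_congr rfl fun k _ => by
          rw [charFun_map_eq_integral Measurable.of_discrete.aemeasurable, hr]

theorem iIndepFun_comp_mult (hx : 0 < x) {g : ℕ → ℝ → ℝ} (hg : ∀ k, Measurable (g k)) :
    iIndepFun ((parts t n).restrict fun k (l : Part t n) => g k (mult k l))
      (boltzmann t n x) :=
  (iIndepFun_mult hx).comp (fun k : parts t n => g k) fun k => hg k

theorem variance_mult (hx : 0 < x) {k : ℕ} (hk : k ∈ parts t n) :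
    Var[fun l : Part t n => (mult k l : ℝ); boltzmann t n x] = prob x k * (1 - prob x k) := by
  have := isProbabilityMeasure_boltzmann t n hx
  rw [variance_eq_mul_of_ae_eq_zero_or_one Measurable.of_discrete.aemeasurable
    (.of_forall (mult_eq_zero_or_one k)), integral_mult hx.le hk]

theorem integral_N (hx : 0 < x) :
    ∫ l : Part t n, N l ∂boltzmann t n x = ∑ k ∈ parts t n, k * prob x k := by
  have := isProbabilityMeasure_boltzmann t n hx
  unfold N
  rw [integral_finsetSum _ fun k _ => .of_finite]
  exact Finset.sum_congr rfl fun k hk => by rw [integral_const_mul, integral_mult hx.le hk]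

theorem sigma_sq (hx : 0 < x) :
    sigma t n x ^ 2 = ∑ k ∈ parts t n, k ^ 2 * (prob x k * (1 - prob x k)) := by
  have := isProbabilityMeasure_boltzmann t n hx
  have hind := iIndepFun_comp_mult (t := t) (n := n) hx (g := fun k z => k * z)
    fun k => measurable_const_mul _
  have hN : (N : Part t n → ℝ) = ∑ k ∈ parts t n, fun l => (k : ℝ) * mult k l := by
    ext l
    rw [Finset.sum_apply, N]
  rw [sigma, Real.sq_sqrt (variance_nonneg _ _), hN, IndepFun.variance_sum (fun k _ => .of_discrete)
    fun j hj k hk hjk => hind.indepFun (i := ⟨j, hj⟩) (j := ⟨k, hk⟩) (by simpa using hjk)]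
  exact Finset.sum_congr rfl fun k hk => by rw [variance_const_mul, variance_mult hx hk]

theorem norm_charFun_map_N_le (hx : 0 < x) (θ : ℝ) :
    ‖charFun ((boltzmann t n x).map N) θ‖
      ≤ Real.exp (-∑ k ∈ parts t n, prob x k * (1 - prob x k) * (1 - Real.cos (k * θ))) := by
  have := isProbabilityMeasure_boltzmann t n hx
  have hprod : charFun ((boltzmann t n x).map N)
      = ∏ k ∈ parts t n, charFun ((boltzmann t n x).map fun l => (k : ℝ) * mult k l) :=
    (iIndepFun_comp_mult hx (g := fun k z => k * z)
      fun k => measurable_const_mul _).charFun_map_fun_finsetSum_eq_prod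
      fun k _ => Measurable.of_discrete.aemeasurable
  rw [hprod, Finset.prod_apply, norm_prod, ← Finset.sum_neg_distrib, Real.exp_sum]
  refine Finset.prod_le_prod (fun _ _ => norm_nonneg _) fun k hk => ?_
  rw [charFun_map_mul_comp Measurable.of_discrete.aemeasurable, ← variance_mult hx hk]
  exact norm_charFun_map_le_of_ae_eq_zero_or_one Measurable.of_discrete.aemeasurable
    (.of_forall (mult_eq_zero_or_one k)) _

end Boltzmann

/-- The tilts `x_n` for which the variances of the multiplicities `X_k` of the admissible parts are
bounded away from zero, uniformly in `k` and `n`. -/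
structure Nondegenerate (t : ℝ) (x : ℕ → ℝ) : Prop where
  pos : ∀ n, 0 < x n
  exists_le_prob_mul : ∃ c > 0, ∀ n, ∀ k ∈ parts t n, c ≤ prob (x n) k * (1 - prob (x n) k)

theorem sigma_nonneg (t : ℝ) (n : ℕ) (x : ℝ) : 0 ≤ sigma t n x := Real.sqrt_nonneg _

theorem sigma_sq_le_sum_sq (t : ℝ) (n : ℕ) {x : ℝ} (hx : 0 < x) :
    sigma t n x ^ 2 ≤ ∑ k ∈ parts t n, (k : ℝ) ^ 2 := by
  rw [sigma_sq hx]
  refine Finset.sum_le_sum fun k _ => mul_le_of_le_one_right (sq_nonneg _) ?_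
  nlinarith [prob_nonneg hx.le k, prob_le_one hx.le k]

theorem tendsto_floor_mul_sqrt {t : ℝ} (ht : 0 < t) :
    Tendsto (fun n : ℕ => (⌊t * √(n : ℝ)⌋₊ : ℝ)) atTop atTop :=
  tendsto_natCast_atTop_atTop.comp <| tendsto_nat_floor_atTop.comp <|
    (Real.tendsto_sqrt_atTop.comp tendsto_natCast_atTop_atTop).const_mul_atTop ht

namespace Nondegenerate

variable {t : ℝ} {x : ℕ → ℝ}

theorem exists_mul_cube_le_sigma_sq (h : Nondegenerate t x) :
    ∃ c > 0, ∀ n : ℕ, c * (⌊t * √(n : ℝ)⌋₊ : ℝ) ^ 3 ≤ sigma t n (x n) ^ 2 := by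
  obtain ⟨c, hc, hcx⟩ := h.exists_le_prob_mul
  refine ⟨c / 3, by positivity, fun n => ?_⟩
  calc c / 3 * (⌊t * √(n : ℝ)⌋₊ : ℝ) ^ 3
      = c * ((⌊t * √(n : ℝ)⌋₊ : ℝ) ^ 3 / 3) := by ring
    _ ≤ c * ∑ k ∈ parts t n, (k : ℝ) ^ 2 :=
        mul_le_mul_of_nonneg_left (cube_div_three_le_sum_sq _) hc.le
    _ ≤ sigma t n (x n) ^ 2 := by
        rw [sigma_sq (h.pos n), Finset.mul_sum]
        refine Finset.sum_le_sum fun k hk => ?_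
        rw [mul_comm]
        exact mul_le_mul_of_nonneg_left (hcx n k hk) (sq_nonneg _)

theorem tendsto_floor_div_sigma (h : Nondegenerate t x) (ht : 0 < t) :
    Tendsto (fun n : ℕ => (⌊t * √(n : ℝ)⌋₊ : ℝ) / sigma t n (x n)) atTop (𝓝 0) := by
  obtain ⟨c, hc, hcσ⟩ := h.exists_mul_cube_le_sigma_sq
  have hlim : Tendsto (fun n : ℕ => √(1 / c / (⌊t * √(n : ℝ)⌋₊ : ℝ))) atTop (𝓝 0) := by
    simpa using ((tendsto_floor_mul_sqrt ht).const_div_atTop (1 / c)).sqrt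
  refine squeeze_zero' (.of_forall fun n => div_nonneg (Nat.cast_nonneg _) (sigma_nonneg _ _ _)) ?_
    hlim
  filter_upwards [(tendsto_floor_mul_sqrt ht).eventually_gt_atTop 0] with n hM
  have hσ := hcσ n
  set M : ℝ := (⌊t * √(n : ℝ)⌋₊ : ℝ)
  refine Real.le_sqrt_of_sq_le ?_
  rw [div_pow, div_le_iff₀ ((by positivity : 0 < c * M ^ 3).trans_le hσ)]
  calc M ^ 2 = 1 / c / M * (c * M ^ 3) := by field_simp
    _ ≤ 1 / c / M * sigma t n (x n) ^ 2 := mul_le_mul_of_nonneg_left hσ (by positivity)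

theorem eventually_sigma_pos (h : Nondegenerate t x) (ht : 0 < t) :
    ∀ᶠ n in atTop, 0 < sigma t n (x n) := by
  obtain ⟨c, hc, hcσ⟩ := h.exists_mul_cube_le_sigma_sq
  filter_upwards [(tendsto_floor_mul_sqrt ht).eventually_gt_atTop 0] with n hM
  have hpos : 0 < c * (⌊t * √(n : ℝ)⌋₊ : ℝ) ^ 3 := by positivity
  exact (sigma_nonneg _ _ _).lt_of_ne' (sq_pos_iff.1 (hpos.trans_le (hcσ n)))

theorem tendsto_sigma (h : Nondegenerate t x) (ht : 0 < t) :
    Tendsto (fun n => sigma t n (x n)) atTop atTop := by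
  refine tendsto_atTop_mono' _ ?_ (tendsto_floor_mul_sqrt ht)
  filter_upwards [(h.tendsto_floor_div_sigma ht).eventually_le_const zero_lt_one,
    h.eventually_sigma_pos ht] with n hn hσ
  rwa [div_le_one hσ] at hn

theorem exists_norm_charFun_map_N_le (h : Nondegenerate t x) (ht : 0 < t) :
    ∃ C, ∀ᶠ n in atTop, ∀ s, |s| ≤ Real.pi * sigma t n (x n) →
      ‖charFun ((boltzmann t n (x n)).map N) (s / sigma t n (x n))‖ ≤ C * (1 + s ^ 2)⁻¹ := by
  obtain ⟨c, hc, hcx⟩ := h.exists_le_prob_mul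
  refine ⟨1 + (48 * Real.pi ^ 2 / c ^ 3 + Real.pi ^ 2 / (2 * c)), ?_⟩
  filter_upwards [h.eventually_sigma_pos ht] with n hσ s hs
  refine (norm_charFun_map_N_le (h.pos n) _).trans (le_trans (Real.exp_le_exp.2 (neg_le_neg ?_))
    (exp_neg_mul_sum_one_sub_cos_le hc hσ (sigma_sq_le_sum_sq t n (h.pos n)) hs))
  rw [Finset.mul_sum]
  exact Finset.sum_le_sum fun k hk =>
    mul_le_mul_of_nonneg_right (hcx n k hk) (sub_nonneg.2 (Real.cos_le_one _))

theorem tendsto_charFun_map_N_sub_mean (h : Nondegenerate t x) (ht : 0 < t) (s : ℝ) :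
    Tendsto (fun n => charFun ((boltzmann t n (x n)).map fun l =>
      N l - ∫ l, N l ∂boltzmann t n (x n)) (s / sigma t n (x n))) atTop
      (𝓝 (Real.exp (-(s ^ 2 / 2)))) := by
  have (n : ℕ) := isProbabilityMeasure_boltzmann t n (h.pos n)
  have hsum (n : ℕ) : (fun l : Part t n => N l - ∫ l, N l ∂boltzmann t n (x n))
      = fun l => ∑ k ∈ parts t n, (k : ℝ) * (mult k l - prob (x n) k) := by
    ext l
    rw [integral_N (h.pos n), N]
    simp only [mul_sub, Finset.sum_sub_distrib]
  simp only [hsum]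
  refine tendsto_charFun_sum_div
    (X := fun n (k : ℕ) (l : Part t n) => (k : ℝ) * (mult k l - prob (x n) k))
    (S := fun n => parts t n) (fun n k _ => Measurable.of_discrete.aemeasurable)
    (fun n => iIndepFun_comp_mult (h.pos n) (g := fun k z => k * (z - prob (x n) k))
      fun k => by fun_prop)
    (fun n k hk => .of_forall fun l => ?_) (fun n k hk => ?_) (fun n => ?_)
    (h.eventually_sigma_pos ht) (h.tendsto_floor_div_sigma ht) s
  · have hkM : (k : ℝ) ≤ ⌊t * √(n : ℝ)⌋₊ := by exact_mod_cast (Finset.mem_Icc.1 hk).2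
    have h1 : |(mult k l : ℝ) - prob (x n) k| ≤ 1 := by
      have h0 := prob_nonneg (h.pos n).le k
      have h1 := prob_le_one (h.pos n).le k
      rw [abs_le]
      rcases mult_eq_zero_or_one k l with hl | hl <;> rw [hl] <;> constructor <;> linarith
    rw [abs_mul, Nat.abs_cast]
    exact (mul_le_of_le_one_right k.cast_nonneg h1).trans hkM
  · rw [integral_const_mul, integral_sub .of_finite .of_finite, integral_mult (h.pos n).le hk]
    simp
  · rw [sigma_sq (h.pos n)]
    exact Finset.sum_congr rfl fun k hk => by
      rw [variance_const_mul, variance_sub_const .of_discrete, variance_mult (h.pos n) hk]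

theorem tendsto_charFun_map_N_sub (h : Nondegenerate t x) (ht : 0 < t) {m : ℕ → ℝ}
    (hm : (fun n => ∫ l, N l ∂boltzmann t n (x n) - m n) =o[atTop] fun n => sigma t n (x n))
    (s : ℝ) :
    Tendsto (fun n => charFun ((boltzmann t n (x n)).map fun l => N l - m n)
      (s / sigma t n (x n))) atTop (𝓝 (Real.exp (-(s ^ 2 / 2)))) := by
  have (n : ℕ) := isProbabilityMeasure_boltzmann t n (h.pos n)
  simpa only [sub_add_sub_cancel] using tendsto_charFun_map_add_of_isLittleO
    (fun n => Measurable.of_discrete.aemeasurable) hm (h.tendsto_charFun_map_N_sub_mean ht s)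

theorem tendsto_measureReal_N_sub_div_le (h : Nondegenerate t x) (ht : 0 < t) {m : ℕ → ℝ}
    (hm : (fun n => ∫ l, N l ∂boltzmann t n (x n) - m n) =o[atTop] fun n => sigma t n (x n))
    (v : ℝ) :
    Tendsto (fun n => (boltzmann t n (x n)).real {l | (N l - m n) / sigma t n (x n) ≤ v}) atTop
      (𝓝 (1 / √(2 * Real.pi) * ∫ u in Set.Iic v, Real.exp (-(u ^ 2) / 2))) :=
  have (n : ℕ) := isProbabilityMeasure_boltzmann t n (h.pos n)
  tendsto_measureReal_div_le (fun _ => .of_discrete) (h.tendsto_charFun_map_N_sub ht hm) v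

theorem isEquivalent_measureReal_N_eq (h : Nondegenerate t x) (ht : 0 < t) {m : ℕ → ℕ}
    (hm : (fun n => ∫ l, N l ∂boltzmann t n (x n) - m n) =o[atTop] fun n => sigma t n (x n)) :
    Asymptotics.IsEquivalent atTop (fun n => (boltzmann t n (x n)).real {l | N l = m n})
      fun n => 1 / (√(2 * Real.pi) * sigma t n (x n)) := by
  have (n : ℕ) := isProbabilityMeasure_boltzmann t n (h.pos n)
  obtain ⟨C, hC⟩ := h.exists_norm_charFun_map_N_le ht
  have hcast (n : ℕ) (l : Part t n) : (((l.size : ℤ) - m n : ℤ) : ℝ) = N l - m n := by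
    rw [N_eq_size, Int.cast_sub, Int.cast_natCast, Int.cast_natCast]
  have hnorm (n : ℕ) (θ : ℝ) : ‖charFun ((boltzmann t n (x n)).map fun l => N l - m n) θ‖
      = ‖charFun ((boltzmann t n (x n)).map N) θ‖ := by
    simp_rw [sub_eq_add_neg]
    rw [charFun_map_fun_add_const Measurable.of_discrete.aemeasurable, norm_mul,
      Complex.norm_exp_ofReal_mul_I, mul_one]
  have hlim := tendsto_mul_measureReal_eq_zero (μ := fun n => boltzmann t n (x n))
    (Z := fun n l => (l.size : ℤ) - m n) (fun _ => .of_discrete) (h.tendsto_sigma ht)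
    (integrable_inv_one_add_sq.const_mul C) (by simpa only [hcast, hnorm] using hC)
    (by simpa only [hcast] using h.tendsto_charFun_map_N_sub ht hm)
  have hevent (n : ℕ) : {l : Part t n | (l.size : ℤ) - m n = 0} = {l | N l = m n} := by
    ext l
    rw [Set.mem_ofPred_eq, Set.mem_ofPred_eq, ← sub_eq_zero (a := N l), ← hcast, Int.cast_eq_zero]
  simp only [hevent] at hlim
  refine Asymptotics.isEquivalent_of_tendsto_one ?_
  have hone := hlim.const_mul √(2 * Real.pi)
  rw [mul_one_div_cancel (by positivity)] at hone
  refine hone.congr fun n => ?_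
  rw [Pi.div_apply, div_div_eq_mul_div, div_one]
  ring

end Nondegenerate

/-- The parameter `x_n = e^{-y/√n}` at an arbitrary real `y` in place of `β(t)`. -/
noncomputable def tilt (y : ℝ) (n : ℕ) : ℝ := Real.exp (-y / √(n : ℝ))

theorem sqrt_pos_of_mem_parts {t : ℝ} {n k : ℕ} (hk : k ∈ parts t n) : 0 < √(n : ℝ) := by
  obtain ⟨hk1, hkt⟩ := mem_parts.1 hk
  refine (Real.sqrt_nonneg _).lt_of_ne' fun h => ?_
  rw [h, mul_zero] at hkt
  exact hkt.not_gt (by exact_mod_cast hk1)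

theorem tilt_pos (y : ℝ) (n : ℕ) : 0 < tilt y n := Real.exp_pos _

theorem tilt_pow (y : ℝ) (n k : ℕ) :
    tilt y n ^ k = Real.exp (-(y * (k * (√(n : ℝ))⁻¹))) := by
  rw [tilt, ← Real.exp_nat_mul]
  congr 1
  ring

theorem nondegenerate_tilt (t y : ℝ) : Nondegenerate t (tilt y) where
  pos := tilt_pos y
  exists_le_prob_mul := by
    refine ⟨Real.exp (-(|y| * t)) / (1 + Real.exp (|y| * t)) ^ 2, by positivity, fun n k hk => ?_⟩
    have hn := sqrt_pos_of_mem_parts hk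
    have hu : k * (√(n : ℝ))⁻¹ ≤ t := by
      rw [← div_eq_mul_inv, div_le_iff₀ hn]
      exact (mem_parts.1 hk).2
    have habs : |-(y * (k * (√(n : ℝ))⁻¹))| ≤ |y| * t := by
      rw [abs_neg, abs_mul, abs_of_nonneg (by positivity : 0 ≤ k * (√(n : ℝ))⁻¹)]
      exact mul_le_mul_of_nonneg_left hu (abs_nonneg _)
    obtain ⟨hlow, hup⟩ := abs_le.1 habs
    rw [prob_mul_one_sub_prob (tilt_pos y n).le k, tilt_pow]
    gcongr

theorem exists_lipschitzOnWith_integrand (t y : ℝ) :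
    ∃ K, LipschitzOnWith K (integrand y) (Set.Icc 0 t) := by
  have hsmooth : ContDiff ℝ 1 (integrand y) := by
    unfold integrand
    exact ContDiff.div (by fun_prop) (by fun_prop) fun u => by positivity
  exact hsmooth.locallyLipschitz.locallyLipschitzOn.exists_lipschitzOnWith_of_compact isCompact_Icc

theorem abs_integrand_le (y : ℝ) {t u : ℝ} (hu : u ∈ Set.Icc 0 t) : |integrand y u| ≤ t := by
  rw [integrand_eq, abs_of_nonneg (div_nonneg hu.1 (by positivity))]
  exact (div_le_self hu.1 (le_add_of_nonneg_right (Real.exp_pos _).le)).trans hu.2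

theorem integral_N_tilt (t y : ℝ) (n : ℕ) :
    ∫ l, N l ∂boltzmann t n (tilt y n)
      = n * ∑ k ∈ parts t n, (√(n : ℝ))⁻¹ * integrand y (k * (√(n : ℝ))⁻¹) := by
  rw [integral_N (tilt_pos y n), Finset.mul_sum]
  refine Finset.sum_congr rfl fun k hk => ?_
  have hn := sqrt_pos_of_mem_parts hk
  rw [prob, tilt_pow, integrand]
  nth_rewrite 3 [← Real.mul_self_sqrt n.cast_nonneg]
  field_simp

theorem isBigO_integral_N_tilt_sub {t : ℝ} (ht : 0 < t) (y : ℝ) :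
    (fun n : ℕ => ∫ l, N l ∂boltzmann t n (tilt y n) - n * ∫ u in (0 : ℝ)..t, integrand y u)
      =O[atTop] fun n : ℕ => (⌊t * √(n : ℝ)⌋₊ : ℝ) := by
  obtain ⟨K, hK⟩ := exists_lipschitzOnWith_integrand t y
  refine .of_bound ((K * t + t) * (2 / t)) ?_
  filter_upwards [eventually_gt_atTop 0, (tendsto_floor_mul_sqrt ht).eventually_ge_atTop 1]
    with n hn hM
  have hs : 0 < √(n : ℝ) := Real.sqrt_pos.2 (by exact_mod_cast hn)
  have hss : (n : ℝ) * (√(n : ℝ))⁻¹ = √(n : ℝ) := by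
    rw [← div_eq_mul_inv, Real.div_sqrt]
  have hfloor := (Nat.lt_floor_add_one (t * √(n : ℝ))).le
  have hriemann := abs_riemannSum_sub_integral_le hK (fun u => abs_integrand_le y)
    (h := (√(n : ℝ))⁻¹) (M := ⌊t * √(n : ℝ)⌋₊) (by positivity)
    (by rw [← div_eq_mul_inv, div_le_iff₀ hs]; exact Nat.floor_le (by positivity))
    (by rwa [← div_eq_mul_inv, le_div_iff₀ hs])
  rw [integral_N_tilt, ← mul_sub, norm_mul, Real.norm_natCast, Real.norm_natCast]
  calc _ ≤ n * ((K * t + t) * (√(n : ℝ))⁻¹) := mul_le_mul_of_nonneg_left hriemann n.cast_nonneg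
    _ = (K * t + t) * √(n : ℝ) := by rw [mul_left_comm, hss]
    _ ≤ (K * t + t) * (2 / t * ⌊t * √(n : ℝ)⌋₊) := by
        gcongr
        rw [div_mul_eq_mul_div, le_div_iff₀ ht]
        linarith
    _ = _ := by ring

theorem isLittleO_integral_N_tilt_sub {t : ℝ} (ht : 0 < t) (y : ℝ) :
    (fun n : ℕ => ∫ l, N l ∂boltzmann t n (tilt y n) - n * ∫ u in (0 : ℝ)..t, integrand y u)
      =o[atTop] fun n => sigma t n (tilt y n) := by
  have h := nondegenerate_tilt t y
  refine (isBigO_integral_N_tilt_sub ht y).trans_isLittleO ?_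
  exact (Asymptotics.isLittleO_iff_tendsto' ((h.eventually_sigma_pos ht).mono fun n hn h0 =>
    absurd h0 hn.ne')).2 (h.tendsto_floor_div_sigma ht)

end DistinctParts

open DistinctParts in
theorem proposition3p3_general {t : ℝ} (ht : 0 < t) (y : ℝ) {m : ℕ → ℕ}
    (hm : (fun n : ℕ => (m n : ℝ) - n * ∫ u in (0 : ℝ)..t, integrand y u)
      =o[atTop] fun n => sigma t n (tilt y n)) :
    (∀ v : ℝ, Tendsto
      (fun n => (boltzmann t n (tilt y n)).real {l | (N l - m n) / sigma t n (tilt y n) ≤ v}) atTop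
      (𝓝 (1 / √(2 * Real.pi) * ∫ u in Set.Iic v, Real.exp (-(u ^ 2) / 2)))) ∧
    Asymptotics.IsEquivalent atTop
      (fun n => (boltzmann t n (tilt y n)).real {l | N l = m n})
      fun n => 1 / (√(2 * Real.pi) * sigma t n (tilt y n)) := by
  have h := nondegenerate_tilt t y
  have hmean : (fun n => ∫ l, N l ∂boltzmann t n (tilt y n) - m n)
      =o[atTop] fun n => sigma t n (tilt y n) := by
    simpa using (isLittleO_integral_N_tilt_sub ht y).sub hm
  exact ⟨h.tendsto_measureReal_N_sub_div_le ht hmean, h.isEquivalent_measureReal_N_eq ht hmean⟩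

theorem proposition3p3 (t : ℝ) (ht : √2 < t) :
    (∀ v : ℝ,
      Tendsto
        (fun n : ℕ =>
          (DistinctParts.boltzmann t n (DistinctParts.param t ht n)).real
            {l | (DistinctParts.N l - (n : ℝ)) /
                DistinctParts.sigma t n (DistinctParts.param t ht n) ≤ v})
        atTop
        (𝓝 (1 / √(2 * Real.pi) * ∫ u in Set.Iic v, Real.exp (-(u ^ 2) / 2)))) ∧
    Asymptotics.IsEquivalent atTop
      (fun n : ℕ =>
        (DistinctParts.boltzmann t n (DistinctParts.param t ht n)).real
          {l | DistinctParts.N l = (n : ℝ)})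
      (fun n : ℕ =>
        1 / (√(2 * Real.pi) * DistinctParts.sigma t n (DistinctParts.param t ht n))) := by
  exact proposition3p3_general ((Real.sqrt_nonneg 2).trans_lt ht) (DistinctParts.beta t ht)
    (m := fun n => n) (by simp [← DistinctParts.beta_spec])
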